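/- **Setting.** A metrized graph $\Gamma$ is a finite connected graph (loops and multiple edges allowed) with a finite non-empty vertex set, in which every edge $e_i$ has a length $L_i>0$ and is identified with $[0,L_i]$, its end points $p_i$ and $q_i$ corresponding to $0$ and $L_i$. A point of $e_i$ is denoted by the same letter as its parameter in $[0,L_i]$. An edge is a *bridge* if deleting its interior disconnects $\Gamma$. For $x,y,z\in\Gamma$, the voltage $j_z(x,y)$ is the potential at $x$, relative to potential $0$ at $z$, when a unit current enters at $y$ and exits at $z$ and every edge has resistance equal to its length; that is, $j_z(\cdot,y)$ is the continuous piecewise affine function $f$ on $\Gamma$ with $\Delta f=\delta_y-\delta_z$ and $f(z)=0$, where $\Delta f$ has at each point the mass minus the sum of the outgoing slopes of $f$. Put $r(x,y)=j_y(x,x)$. For a real-valued signed Borel measure $\mu$ on $\Gamma$ of total mass $1$ put $j_\mu(x,y)=\int_\Gamma j_z(x,y)\,d\mu(z)$ and $$g_\mu(x,y)=\int_\Gamma j_z(x,y)\,d\mu(z)-\int_{\Gamma}\int_\Gamma\int_\Gamma j_z(x',y')\,d\mu(z)\,d\mu(x')\,d\mu(y').$$ The canonical measure $\mu_{can}$ is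 the unique such $\mu$ for which $j_\mu(x,x)$ is constant on $\Gamma$, and the tau constant is $\tau(\Gamma)=\tfrac12 j_{\mu_{can}}(x,x)$. **Theorem.** Let $e_i$ and $e_j$ be distinct edges of $\Gamma$ that are not bridges (their end points need not be distinct). If $x$ belongs to $e_i$ and $y$ belongs to $e_j$, then $$\begin{aligned} g_{\mu_{can}}(x,y) ={}& \tau(\Gamma) +x^2\, \frac{L_i - r(p_i,q_i)}{2L_i^2}+y^2\, \frac{L_j - r(p_j,q_j)}{2L_j^2} -\frac{xy}{L_i L_j} \big(j_{p_j}(p_i,q_j)-j_{p_j}(q_i,q_j)\big)\\ & -\frac{x}{2L_i} \big(L_i-2j_{p_i}(q_i,p_j)\big) -\frac{y}{2L_j} \big(L_j-2j_{p_j}(p_i,q_j)\big) -\frac{1}{2}\,r(p_i,p_j). \end{aligned}$$ If $x$ and $y$ belong to the same edge $e_i$ of $\Gamma$, then $$g_{\mu_{can}}(x,y) = \tau(\Gamma) - \frac{1}{2}|x-y|+(x-y)^2\, \frac{L_i - r(p_i,q_i)}{2L_i^2}.$$ -/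

import Mathlib

/-- A metrized graph: a finite connected multigraph with vertex set `V` and edge set `E` (loops and
multiple edges allowed).  The edge `e` is parametrized by `[0, length e]`; the parameter `0`
corresponds to the end point `src e` and `length e` to the end point `tgt e`. -/
structure MetrizedGraph (V E : Type*) where
  src : E → V
  tgt : E → V
  length : E → ℝ
  length_pos : ∀ e, 0 < length e
  nonempty : Nonempty V
  connected : ∀ u v : V, Relation.EqvGen (fun a b => ∃ e, src e = a ∧ tgt e = b) u v

noncomputable section

namespace MetrizedGraph

open MeasureTheory Set

variable {V E : Type*} (Γ : MetrizedGraph V E)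

/-- `e` is a bridge: deleting the interior of `e` disconnects the graph. -/
def IsBridge (e : E) : Prop :=
  ¬ ∀ u v : V, Relation.EqvGen (fun a b => ∃ e', e' ≠ e ∧ Γ.src e' = a ∧ Γ.tgt e' = b) u v

/-- The disjoint union of the vertices and of the closed segments `[0, length e]`. -/
def PrePoint : Type _ := V ⊕ (Σ e : E, Icc (0 : ℝ) (Γ.length e))

/-- Vertices carry the discrete topology, segments their usual topology. -/
instance : TopologicalSpace Γ.PrePoint :=
  letI : TopologicalSpace V := ⊥
  inferInstanceAs (TopologicalSpace (V ⊕ (Σ e : E, Icc (0 : ℝ) (Γ.length e))))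

/-- The gluing of the ends of the segments to the vertices. -/
inductive Glue : Γ.PrePoint → Γ.PrePoint → Prop
  | src (e : E) : Glue (Sum.inr ⟨e, ⟨0, le_rfl, (Γ.length_pos e).le⟩⟩) (Sum.inl (Γ.src e))
  | tgt (e : E) : Glue (Sum.inr ⟨e, ⟨Γ.length e, (Γ.length_pos e).le, le_rfl⟩⟩)
      (Sum.inl (Γ.tgt e))

/-- The points of the metrized graph, as a topological space (quotient topology). -/
def Point : Type _ := Quot Γ.Glue

instance : TopologicalSpace Γ.Point := inferInstanceAs (TopologicalSpace (Quot Γ.Glue))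

instance : MeasurableSpace Γ.Point := borel _

instance : BorelSpace Γ.Point := ⟨rfl⟩

/-- A vertex as a point of the graph. -/
def vertex (v : V) : Γ.Point := Quot.mk _ (Sum.inl v)

/-- The point of the edge `e` with parameter `t ∈ [0, length e]`. -/
def edgePoint (e : E) (t : Icc (0 : ℝ) (Γ.length e)) : Γ.Point := Quot.mk _ (Sum.inr ⟨e, t⟩)

/-- The end point of the edge `e` with parameter `0`. -/
def startPoint (e : E) : Γ.Point := Γ.vertex (Γ.src e)

/-- The end point of the edge `e` with parameter `length e`. -/
def endPoint (e : E) : Γ.Point := Γ.vertex (Γ.tgt e)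

variable {Γ}

/-- The function `f` read in the parameter of the edge `e`; outside `[0, length e]` it is extended
by its values at the end points. -/
def onEdge (f : Γ.Point → ℝ) (e : E) (t : ℝ) : ℝ :=
  f (Γ.edgePoint e (projIcc 0 (Γ.length e) (Γ.length_pos e).le t))

/-- `f` is continuous and piecewise affine: on every edge it is affine on all closed subintervals
that have none of finitely many break points in their interior. -/
def IsPiecewiseAffine (f : Γ.Point → ℝ) : Prop :=
  ∀ e : E, ∃ S : Finset ℝ, ∀ a b : ℝ, 0 ≤ a → a < b → b ≤ Γ.length e →
    (∀ s ∈ S, s ∉ Ioo a b) → ∃ m c : ℝ, ∀ t ∈ Icc a b, onEdge f e t = m * t + c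

/-- The slope of `f` on the edge `e` at the parameter `t`, in the direction of increasing
parameter. -/
def slopeForward (f : Γ.Point → ℝ) (e : E) (t : ℝ) : ℝ := derivWithin (onEdge f e) (Ici t) t

/-- The slope of `f` on the edge `e` at the parameter `t`, in the direction of decreasing
parameter. -/
def slopeBackward (f : Γ.Point → ℝ) (e : E) (t : ℝ) : ℝ := -derivWithin (onEdge f e) (Iic t) t

open Classical in
/-- The mass of the Laplacian `Δ f` at a vertex: minus the sum of the outgoing slopes of `f` over
all directions at the vertex.  A loop contributes two directions. -/
def laplacianVertex [Fintype E] (f : Γ.Point → ℝ) (v : V) : ℝ :=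
  -∑ e : E, ((if Γ.src e = v then slopeForward f e 0 else 0) +
    (if Γ.tgt e = v then slopeBackward f e (Γ.length e) else 0))

/-- The mass of the Laplacian `Δ f` at the interior point of the edge `e` with parameter `t`: minus
the sum of the two outgoing slopes. -/
def laplacianEdge (f : Γ.Point → ℝ) (e : E) (t : ℝ) : ℝ :=
  -(slopeForward f e t + slopeBackward f e t)

open Classical in
/-- `unitMass y p` is the mass at `p` of the Dirac measure `δ_y`. -/
def unitMass (y p : Γ.Point) : ℝ := if p = y then 1 else 0

/-- `f` is the electric potential for a unit current that enters at `y` and exits at `z`, with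
reference potential `0` at `z`, where every edge has a resistance equal to its length: `f` is
continuous and piecewise affine, `Δ f = δ_y - δ_z`, and `f z = 0`. -/
structure IsPotential [Fintype E] (z y : Γ.Point) (f : Γ.Point → ℝ) : Prop where
  piecewiseAffine : IsPiecewiseAffine f
  laplacian_vertex : ∀ v : V,
    laplacianVertex f v = unitMass y (Γ.vertex v) - unitMass z (Γ.vertex v)
  laplacian_edge : ∀ (e : E) (t : Icc (0 : ℝ) (Γ.length e)),
    0 < (t : ℝ) → (t : ℝ) < Γ.length e →
      laplacianEdge f e t = unitMass y (Γ.edgePoint e t) - unitMass z (Γ.edgePoint e t)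
  map_ground : f z = 0

/-- The voltage function `j_z(x, y)`: the potential at `x` when a unit current enters at `y` and
exits at `z`, relative to the potential at `z`. -/
def voltage [Fintype E] (z x y : Γ.Point) : ℝ := Classical.epsilon (IsPotential z y) x

/-- The resistance function `r(x, y) = j_y(x, x)`. -/
def resistance [Fintype E] (x y : Γ.Point) : ℝ := voltage y x x

/-- `j_μ(x, y) = ∫ j_z(x, y) dμ(z)` for a real-valued signed Borel measure `μ`. -/
def voltageMeasure [Fintype E] (μ : SignedMeasure Γ.Point) (x y : Γ.Point) : ℝ :=
  ∫ᵛ z, voltage z x y ∂<•μ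

/-- The Arakelov-Green function
`g_μ(x, y) = ∫ j_z(x, y) dμ(z) - ∫∫∫ j_z(x', y') dμ(z) dμ(x') dμ(y')`. -/
def arakelovGreen [Fintype E] (μ : SignedMeasure Γ.Point) (x y : Γ.Point) : ℝ :=
  (∫ᵛ z, voltage z x y ∂<•μ) -
    ∫ᵛ y', (∫ᵛ x', (∫ᵛ z, voltage z x' y' ∂<•μ) ∂<•μ) ∂<•μ

/-- `μ` has total mass `1` and `j_μ(x, x)` is constant. -/
def IsCanonicalMeasure [Fintype E] (μ : SignedMeasure Γ.Point) : Prop :=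
  μ univ = 1 ∧ ∃ c : ℝ, ∀ x, voltageMeasure μ x x = c

variable (Γ)

/-- The canonical measure `μ_can`: the signed Borel measure `μ` of total mass `1` for which
`j_μ(x, x)` is constant. -/
def canonicalMeasure [Fintype E] : SignedMeasure Γ.Point :=
  Classical.epsilon IsCanonicalMeasure

/-- The tau constant `τ(Γ)`: the constant value of `j_μ(x, x) / 2` for `μ = μ_can`. -/
def tau [Fintype E] : ℝ :=
  Classical.epsilon fun t : ℝ => ∀ x, t = voltageMeasure Γ.canonicalMeasure x x / 2

end MetrizedGraph

end

/-!
Invert the weighted Laplacian on the vertices, with one vertex grounded, and interpolate the inverse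
affinely in both variables; adding on each edge the Green function `min s t - s * t / L` of an
interval with grounded ends gives a symmetric kernel `K` on `Γ`. Then
`j_z(x, y) = K(x, y) - K(x, z) - K(z, y) + K(z, z)`, hence
`j_z(x, y) = (r(x, z) + r(y, z) - r(x, y)) / 2`, and the shape of `r` on a product of two edges is
read off from that of `K`.

A combination of point masses at the vertices and of densities `(L - r(p, q)) / L ^ 2` on the edges
makes `∫ r(x, z) dμ(z)` independent of `x`. Integrating the formula for `j_z` against a canonical
measure then gives `g(x, y) = τ - r(x, y) / 2`.
-/

noncomputable section

namespace MetrizedGraph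

open MeasureTheory Set

variable {V E : Type*} {Γ : MetrizedGraph V E}

/-! ### Points of the graph -/

theorem edgePoint_zero (e : E) :
    Γ.edgePoint e ⟨0, le_rfl, (Γ.length_pos e).le⟩ = Γ.vertex (Γ.src e) :=
  Quot.sound (Glue.src e)

theorem edgePoint_length (e : E) :
    Γ.edgePoint e ⟨Γ.length e, (Γ.length_pos e).le, le_rfl⟩ = Γ.vertex (Γ.tgt e) :=
  Quot.sound (Glue.tgt e)

/-- The function on `Γ` glued from the function `φ` on the vertices and the functions `ψ e` on the
segments. -/
def Point.lift {α : Type*} (φ : V → α) (ψ : ∀ e, Icc (0 : ℝ) (Γ.length e) → α)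
    (h0 : ∀ e, ψ e ⟨0, le_rfl, (Γ.length_pos e).le⟩ = φ (Γ.src e))
    (h1 : ∀ e, ψ e ⟨Γ.length e, (Γ.length_pos e).le, le_rfl⟩ = φ (Γ.tgt e)) : Γ.Point → α :=
  Quot.lift (Sum.elim φ fun p => ψ p.1 p.2) <| by
    rintro _ _ (e | e)
    exacts [h0 e, h1 e]

theorem point_cases {P : Γ.Point → Prop} (vertex : ∀ v, P (Γ.vertex v))
    (edge : ∀ (e : E) (t : Icc (0 : ℝ) (Γ.length e)), 0 < (t : ℝ) → (t : ℝ) < Γ.length e →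
      P (Γ.edgePoint e t)) (x : Γ.Point) : P x := by
  induction x using Quot.ind with
  | _ p =>
  obtain v | ⟨e, t, h0, h1⟩ := p
  · exact vertex v
  · change P (Γ.edgePoint e ⟨t, h0, h1⟩)
    rcases h0.eq_or_lt with rfl | h0'
    · exact edgePoint_zero (Γ := Γ) e ▸ vertex _
    rcases h1.eq_or_lt with rfl | h1'
    · exact edgePoint_length (Γ := Γ) e ▸ vertex _
    exact edge e _ h0' h1'

/-- Either the vertex that `x` is, or the edge and the parameter of the interior point that `x`
is. -/
def normalForm : Γ.Point → V ⊕ (E × ℝ) :=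
  open Classical in
  Point.lift Sum.inl
    (fun e t => if (t : ℝ) = 0 then Sum.inl (Γ.src e)
      else if (t : ℝ) = Γ.length e then Sum.inl (Γ.tgt e) else Sum.inr (e, t))
    (fun _ => if_pos rfl) (fun e => by simp [(Γ.length_pos e).ne'])

theorem normalForm_vertex (v : V) : normalForm (Γ.vertex v) = Sum.inl v := rfl

theorem normalForm_edgePoint {e : E} {t : Icc (0 : ℝ) (Γ.length e)} (h0 : 0 < (t : ℝ))
    (h1 : (t : ℝ) < Γ.length e) : normalForm (Γ.edgePoint e t) = Sum.inr (e, (t : ℝ)) :=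
  (if_neg h0.ne').trans (if_neg h1.ne)

theorem vertex_injective : Function.Injective Γ.vertex := fun _ _ h =>
  Sum.inl_injective (congrArg normalForm h)

theorem edgePoint_ne_vertex {e : E} {t : Icc (0 : ℝ) (Γ.length e)} (h0 : 0 < (t : ℝ))
    (h1 : (t : ℝ) < Γ.length e) (v : V) : Γ.edgePoint e t ≠ Γ.vertex v := fun h => by
  simpa [normalForm_edgePoint h0 h1, normalForm_vertex] using congrArg normalForm h

theorem edgePoint_eq_iff {e e' : E} {t : Icc (0 : ℝ) (Γ.length e)}
    {s : Icc (0 : ℝ) (Γ.length e')} (ht0 : 0 < (t : ℝ)) (ht1 : (t : ℝ) < Γ.length e)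
    (hs0 : 0 < (s : ℝ)) (hs1 : (s : ℝ) < Γ.length e') :
    Γ.edgePoint e t = Γ.edgePoint e' s ↔ e = e' ∧ (t : ℝ) = s := by
  constructor
  · intro h
    simpa [normalForm_edgePoint, ht0, ht1, hs0, hs1] using congrArg normalForm h
  · rintro ⟨rfl, h⟩
    rw [Subtype.ext h]

theorem onEdge_apply (f : Γ.Point → ℝ) (e : E) {t : ℝ} (ht : t ∈ Icc (0 : ℝ) (Γ.length e)) :
    onEdge f e t = f (Γ.edgePoint e ⟨t, ht⟩) := by
  rw [onEdge, projIcc_of_mem _ ht]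

theorem onEdge_zero (f : Γ.Point → ℝ) (e : E) : onEdge f e 0 = f (Γ.vertex (Γ.src e)) := by
  rw [onEdge_apply f e ⟨le_rfl, (Γ.length_pos e).le⟩, edgePoint_zero]

theorem onEdge_length (f : Γ.Point → ℝ) (e : E) :
    onEdge f e (Γ.length e) = f (Γ.vertex (Γ.tgt e)) := by
  rw [onEdge_apply f e ⟨(Γ.length_pos e).le, le_rfl⟩, edgePoint_length]

theorem continuous_of_continuous_edgePoint {α : Type*} [TopologicalSpace α] {f : Γ.Point → α}
    (hf : ∀ e, Continuous fun t => f (Γ.edgePoint e t)) : Continuous f := by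
  let : TopologicalSpace V := ⊥
  have : DiscreteTopology V := ⟨rfl⟩
  exact isQuotientMap_quot_mk.continuous_iff.2
    (continuous_sum_dom.2 ⟨continuous_of_discreteTopology, continuous_sigma hf⟩)

theorem continuous_edgePoint (e : E) : Continuous (Γ.edgePoint e) :=
  letI : TopologicalSpace V := ⊥
  continuous_quot_mk.comp (continuous_inr.comp continuous_sigmaMk)

theorem eq_of_forall_src_eq_tgt (Γ : MetrizedGraph V E) {α : Type*} {F : V → α}
    (hF : ∀ e, F (Γ.src e) = F (Γ.tgt e)) (u v : V) : F u = F v := by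
  induction Γ.connected u v with
  | rel _ _ h => obtain ⟨e, rfl, rfl⟩ := h; exact hF e
  | refl => rfl
  | symm _ _ _ ih => exact ih.symm
  | trans _ _ _ _ _ ih ih' => exact ih.trans ih'

theorem finite_vertices (Γ : MetrizedGraph V E) [Finite E] : Finite V := by
  obtain ⟨o⟩ := Γ.nonempty
  have hV : univ ⊆ insert o (range Γ.src ∪ range Γ.tgt) := fun v _ =>
    (Γ.eq_of_forall_src_eq_tgt (F := (· ∈ insert o (range Γ.src ∪ range Γ.tgt))) (by simp)
      o v).mp (mem_insert _ _)
  exact finite_univ_iff.1 ((toFinite _).subset hV)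

instance [Finite E] : CompactSpace Γ.Point := by
  let : TopologicalSpace V := ⊥
  have := Γ.finite_vertices
  have : CompactSpace Γ.PrePoint :=
    inferInstanceAs (CompactSpace (V ⊕ (Σ e : E, Icc (0 : ℝ) (Γ.length e))))
  exact inferInstanceAs (CompactSpace (Quot Γ.Glue))

/-! ### Piecewise affine functions and their slopes -/

/-- `f` is affine with slope `m` on the part `[a, b]` of the edge `e`. -/
def HasSlopeOn (f : Γ.Point → ℝ) (e : E) (a b m : ℝ) : Prop :=
  ∃ c, ∀ t ∈ Icc a b, onEdge f e t = m * t + c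

namespace HasSlopeOn

variable {f g : Γ.Point → ℝ} {e : E} {a b a' b' m m' t : ℝ}

theorem mono (h : HasSlopeOn f e a b m) (ha : a ≤ a') (hb : b' ≤ b) : HasSlopeOn f e a' b' m :=
  let ⟨c, hc⟩ := h
  ⟨c, fun t ht => hc t ⟨ha.trans ht.1, ht.2.trans hb⟩⟩

theorem add (hf : HasSlopeOn f e a b m) (hg : HasSlopeOn g e a b m') :
    HasSlopeOn (f + g) e a b (m + m') := by
  obtain ⟨c, hc⟩ := hf
  obtain ⟨c', hc'⟩ := hg
  refine ⟨c + c', fun t ht => ?_⟩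
  have hfg : onEdge (f + g) e t = onEdge f e t + onEdge g e t := rfl
  rw [hfg, hc t ht, hc' t ht]
  ring

theorem neg (hf : HasSlopeOn f e a b m) : HasSlopeOn (-f) e a b (-m) := by
  obtain ⟨c, hc⟩ := hf
  refine ⟨-c, fun t ht => ?_⟩
  have hnf : onEdge (-f) e t = -onEdge f e t := rfl
  rw [hnf, hc t ht]
  ring

theorem union (h : HasSlopeOn f e a t m) (h' : HasSlopeOn f e t b m) (hat : a ≤ t)
    (htb : t ≤ b) : HasSlopeOn f e a b m := by
  obtain ⟨c, hc⟩ := h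
  obtain ⟨c', hc'⟩ := h'
  obtain rfl : c = c' := by
    linarith [hc t (right_mem_Icc.2 hat), hc' t (left_mem_Icc.2 htb)]
  exact ⟨c, fun u hu => (le_total u t).elim (fun hut => hc u ⟨hu.1, hut⟩)
    fun htu => hc' u ⟨htu, hu.2⟩⟩

theorem hasDerivWithinAt_Ici (h : HasSlopeOn f e a b m) (hab : a < b) :
    HasDerivWithinAt (onEdge f e) m (Ici a) a := by
  obtain ⟨c, hc⟩ := h
  have hlin : HasDerivWithinAt (fun t => m * t + c) m (Ici a) a := by
    simpa using ((hasDerivAt_id a).const_mul m |>.add_const c).hasDerivWithinAt (s := Ici a)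
  refine hlin.congr_of_eventuallyEq ?_ (hc a (left_mem_Icc.2 hab.le))
  filter_upwards [Icc_mem_nhdsGE hab] with t ht using hc t ht

theorem hasDerivWithinAt_Iic (h : HasSlopeOn f e a b m) (hab : a < b) :
    HasDerivWithinAt (onEdge f e) m (Iic b) b := by
  obtain ⟨c, hc⟩ := h
  have hlin : HasDerivWithinAt (fun t => m * t + c) m (Iic b) b := by
    simpa using ((hasDerivAt_id b).const_mul m |>.add_const c).hasDerivWithinAt (s := Iic b)
  refine hlin.congr_of_eventuallyEq ?_ (hc b (right_mem_Icc.2 hab.le))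
  filter_upwards [Icc_mem_nhdsLE hab] with t ht using hc t ht

theorem slopeForward_eq (h : HasSlopeOn f e a b m) (hab : a < b) : slopeForward f e a = m :=
  (h.hasDerivWithinAt_Ici hab).derivWithin (uniqueDiffWithinAt_Ici a)

theorem slopeBackward_eq (h : HasSlopeOn f e a b m) (hab : a < b) : slopeBackward f e b = -m :=
  congrArg Neg.neg ((h.hasDerivWithinAt_Iic hab).derivWithin (uniqueDiffWithinAt_Iic b))

theorem laplacianEdge_eq (h : HasSlopeOn f e a t m) (h' : HasSlopeOn f e t b m') (hat : a < t)
    (htb : t < b) : laplacianEdge f e t = m - m' := by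
  rw [laplacianEdge, h'.slopeForward_eq htb, h.slopeBackward_eq hat]
  ring

theorem laplacianEdge_eq_zero (h : HasSlopeOn f e a b m) (ht : t ∈ Ioo a b) :
    laplacianEdge f e t = 0 := by
  rw [(h.mono le_rfl ht.2.le).laplacianEdge_eq (h.mono ht.1.le le_rfl) ht.1 ht.2, sub_self]

end HasSlopeOn

theorem exists_mem_Ioo_forall_mem_eq (S : Finset ℝ) (t : ℝ) :
    ∃ l u, t ∈ Ioo l u ∧ ∀ s ∈ S, s ∈ Ioo l u → s = t := by
  have hS : ((S : Set ℝ) \ {t})ᶜ ∈ nhds t :=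
    ((S.finite_toSet.subset sdiff_subset).isClosed.isOpen_compl).mem_nhds (by simp)
  obtain ⟨l, u, ht, hlu⟩ := mem_nhds_iff_exists_Ioo_subset.1 hS
  exact ⟨l, u, ht, fun s hs hslu => by_contra fun hst => hlu hslu ⟨hs, hst⟩⟩

namespace IsPiecewiseAffine

variable {f g : Γ.Point → ℝ} {e : E} {t : ℝ}

theorem add (hf : IsPiecewiseAffine f) (hg : IsPiecewiseAffine g) : IsPiecewiseAffine (f + g) := by
  classical
  intro e
  obtain ⟨S, hS⟩ := hf e
  obtain ⟨T, hT⟩ := hg e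
  refine ⟨S ∪ T, fun a b ha hab hb hST => ?_⟩
  obtain ⟨m, hm⟩ := hS a b ha hab hb fun s hs => hST s (Finset.mem_union_left _ hs)
  obtain ⟨m', hm'⟩ := hT a b ha hab hb fun s hs => hST s (Finset.mem_union_right _ hs)
  exact ⟨m + m', HasSlopeOn.add hm hm'⟩

theorem neg (hf : IsPiecewiseAffine f) : IsPiecewiseAffine (-f) := fun e =>
  let ⟨S, hS⟩ := hf e
  ⟨S, fun a b ha hab hb h => let ⟨m, hm⟩ := hS a b ha hab hb h; ⟨-m, HasSlopeOn.neg hm⟩⟩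

theorem sub (hf : IsPiecewiseAffine f) (hg : IsPiecewiseAffine g) : IsPiecewiseAffine (f - g) :=
  sub_eq_add_neg f g ▸ hf.add hg.neg

theorem differentiableWithinAt_Ici (hf : IsPiecewiseAffine f) (h0 : 0 ≤ t)
    (h1 : t < Γ.length e) : DifferentiableWithinAt ℝ (onEdge f e) (Ici t) t := by
  obtain ⟨S, hS⟩ := hf e
  obtain ⟨l, u, ht, hlu⟩ := exists_mem_Ioo_forall_mem_eq S t
  have htb : t < min u (Γ.length e) := lt_min ht.2 h1
  obtain ⟨m, hm⟩ := hS t _ h0 htb (min_le_right _ _) fun s hs hst =>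
    hst.1.ne' (hlu s hs ⟨ht.1.trans hst.1, hst.2.trans_le (min_le_left _ _)⟩)
  exact (HasSlopeOn.hasDerivWithinAt_Ici hm htb).differentiableWithinAt

theorem differentiableWithinAt_Iic (hf : IsPiecewiseAffine f) (h0 : 0 < t)
    (h1 : t ≤ Γ.length e) : DifferentiableWithinAt ℝ (onEdge f e) (Iic t) t := by
  obtain ⟨S, hS⟩ := hf e
  obtain ⟨l, u, ht, hlu⟩ := exists_mem_Ioo_forall_mem_eq S t
  have hat : max l 0 < t := max_lt ht.1 h0
  obtain ⟨m, hm⟩ := hS _ t (le_max_right _ _) hat h1 fun s hs hst =>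
    hst.2.ne (hlu s hs ⟨(le_max_left _ _).trans_lt hst.1, hst.2.trans ht.2⟩)
  exact (HasSlopeOn.hasDerivWithinAt_Iic hm hat).differentiableWithinAt

theorem slopeForward_add (hf : IsPiecewiseAffine f) (hg : IsPiecewiseAffine g) (h0 : 0 ≤ t)
    (h1 : t < Γ.length e) :
    slopeForward (f + g) e t = slopeForward f e t + slopeForward g e t :=
  derivWithin_add (hf.differentiableWithinAt_Ici h0 h1) (hg.differentiableWithinAt_Ici h0 h1)

theorem slopeBackward_add (hf : IsPiecewiseAffine f) (hg : IsPiecewiseAffine g) (h0 : 0 < t)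
    (h1 : t ≤ Γ.length e) :
    slopeBackward (f + g) e t = slopeBackward f e t + slopeBackward g e t :=
  (congrArg Neg.neg (derivWithin_add (hf.differentiableWithinAt_Iic h0 h1)
    (hg.differentiableWithinAt_Iic h0 h1))).trans (neg_add _ _)

theorem laplacianEdge_add (hf : IsPiecewiseAffine f) (hg : IsPiecewiseAffine g) (h0 : 0 < t)
    (h1 : t < Γ.length e) :
    laplacianEdge (f + g) e t = laplacianEdge f e t + laplacianEdge g e t := by
  rw [laplacianEdge, hf.slopeForward_add hg h0.le h1, hf.slopeBackward_add hg h0 h1.le,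
    laplacianEdge, laplacianEdge]
  ring

theorem laplacianVertex_add [Fintype E] (hf : IsPiecewiseAffine f) (hg : IsPiecewiseAffine g)
    (v : V) : laplacianVertex (f + g) v = laplacianVertex f v + laplacianVertex g v := by
  simp only [laplacianVertex, hf.slopeForward_add hg le_rfl (Γ.length_pos _),
    hf.slopeBackward_add hg (Γ.length_pos _) le_rfl]
  rw [← neg_add, ← Finset.sum_add_distrib]
  refine congrArg Neg.neg (Finset.sum_congr rfl fun e _ => ?_)
  split_ifs <;> ring

end IsPiecewiseAffine

section Neg

variable (f : Γ.Point → ℝ)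

theorem slopeForward_neg (e : E) (t : ℝ) : slopeForward (-f) e t = -slopeForward f e t :=
  derivWithin.neg

theorem slopeBackward_neg (e : E) (t : ℝ) : slopeBackward (-f) e t = -slopeBackward f e t :=
  congrArg Neg.neg derivWithin.neg

theorem laplacianEdge_neg (e : E) (t : ℝ) : laplacianEdge (-f) e t = -laplacianEdge f e t := by
  rw [laplacianEdge, laplacianEdge, slopeForward_neg, slopeBackward_neg, ← neg_add]

theorem laplacianVertex_neg [Fintype E] (v : V) :
    laplacianVertex (-f) v = -laplacianVertex f v := by
  simp only [laplacianVertex, slopeForward_neg, slopeBackward_neg, ← Finset.sum_neg_distrib]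
  refine Finset.sum_congr rfl fun e _ => ?_
  split_ifs <;> ring

end Neg

namespace IsPiecewiseAffine

variable {f g : Γ.Point → ℝ} {e : E} {t : ℝ}

theorem laplacianEdge_sub (hf : IsPiecewiseAffine f) (hg : IsPiecewiseAffine g) (h0 : 0 < t)
    (h1 : t < Γ.length e) :
    laplacianEdge (f - g) e t = laplacianEdge f e t - laplacianEdge g e t := by
  rw [sub_eq_add_neg, hf.laplacianEdge_add hg.neg h0 h1, laplacianEdge_neg, sub_eq_add_neg]

theorem laplacianVertex_sub [Fintype E] (hf : IsPiecewiseAffine f) (hg : IsPiecewiseAffine g)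
    (v : V) : laplacianVertex (f - g) v = laplacianVertex f v - laplacianVertex g v := by
  rw [sub_eq_add_neg, hf.laplacianVertex_add hg.neg, laplacianVertex_neg, sub_eq_add_neg]

theorem exists_hasSlopeOn_of_laplacianEdge_eq_zero (hf : IsPiecewiseAffine f)
    (hΔ : ∀ t, 0 < t → t < Γ.length e → laplacianEdge f e t = 0) :
    ∃ m, HasSlopeOn f e 0 (Γ.length e) m := by
  obtain ⟨S, hS⟩ := hf e
  -- A break point at which the Laplacian vanishes is none, so `S` can be emptied point by point.
  induction S using Finset.induction_on with
  | empty => exact hS 0 _ le_rfl (Γ.length_pos e) le_rfl (by simp)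
  | insert s S _ ih =>
    refine ih fun a b ha hab hb hSab => ?_
    by_cases hs : s ∈ Ioo a b
    · obtain ⟨m, hm⟩ := hS a s ha hs.1 (hs.2.le.trans hb) <| Finset.forall_mem_insert _ _ _ |>.2
        ⟨fun h => h.2.ne rfl, fun u hu h => hSab u hu ⟨h.1, h.2.trans hs.2⟩⟩
      obtain ⟨m', hm'⟩ := hS s b (ha.trans hs.1.le) hs.2 hb <| Finset.forall_mem_insert _ _ _ |>.2
        ⟨fun h => h.1.ne rfl, fun u hu h => hSab u hu ⟨hs.1.trans h.1, h.2⟩⟩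
      obtain rfl : m = m' := by
        rw [← sub_eq_zero, ← HasSlopeOn.laplacianEdge_eq hm hm' hs.1 hs.2]
        exact hΔ s (ha.trans_lt hs.1) (hs.2.trans_le hb)
      exact ⟨m, HasSlopeOn.union hm hm' hs.1.le hs.2.le⟩
    · exact hS a b ha hab hb <| Finset.forall_mem_insert _ _ _ |>.2 ⟨hs, hSab⟩

end IsPiecewiseAffine

/-! ### The weighted Laplacian on the vertices -/

variable (Γ) in
open Classical in
/-- The Laplacian on functions on the vertices, where the edge `e` has weight `1 / length e`. -/
def vertexLaplacian [Fintype E] : (V → ℝ) →ₗ[ℝ] V → ℝ :=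
  ∑ e : E, (LinearMap.proj (R := ℝ) (φ := fun _ : V => ℝ) (Γ.src e)
    - LinearMap.proj (Γ.tgt e)).smulRight
      ((Γ.length e)⁻¹ • (Pi.single (Γ.src e) 1 - Pi.single (Γ.tgt e) 1))

open Classical in
theorem vertexLaplacian_apply [Fintype E] (h : V → ℝ) :
    Γ.vertexLaplacian h = ∑ e : E, ((h (Γ.src e) - h (Γ.tgt e)) / Γ.length e) •
      (Pi.single (Γ.src e) 1 - Pi.single (Γ.tgt e) 1) := by
  simp only [vertexLaplacian, LinearMap.sum_apply, LinearMap.smulRight_apply,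
    LinearMap.sub_apply, LinearMap.proj_apply, smul_smul, div_eq_mul_inv]

section VertexLaplacian

variable [Fintype V] [Fintype E]

theorem dotProduct_vertexLaplacian (k h : V → ℝ) :
    k ⬝ᵥ Γ.vertexLaplacian h =
      ∑ e, (k (Γ.src e) - k (Γ.tgt e)) * (h (Γ.src e) - h (Γ.tgt e)) / Γ.length e := by
  simp only [vertexLaplacian_apply, dotProduct_sum, dotProduct_smul, dotProduct_sub,
    dotProduct_single, smul_eq_mul, mul_one]
  exact Finset.sum_congr rfl fun e _ => by ring

theorem dotProduct_vertexLaplacian_comm (k h : V → ℝ) :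
    k ⬝ᵥ Γ.vertexLaplacian h = h ⬝ᵥ Γ.vertexLaplacian k := by
  simp only [dotProduct_vertexLaplacian, mul_comm]

theorem one_dotProduct_vertexLaplacian (h : V → ℝ) : 1 ⬝ᵥ Γ.vertexLaplacian h = 0 := by
  simp [dotProduct_vertexLaplacian]

end VertexLaplacian

theorem eq_of_vertexLaplacian_eq_zero [Fintype E] {h : V → ℝ} (hh : Γ.vertexLaplacian h = 0)
    (u v : V) : h u = h v := by
  have := Γ.finite_vertices
  have := Fintype.ofFinite V
  have henergy :
      ∑ e, (h (Γ.src e) - h (Γ.tgt e)) * (h (Γ.src e) - h (Γ.tgt e)) / Γ.length e = 0 := by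
    rw [← dotProduct_vertexLaplacian, hh, dotProduct_zero]
  rw [Finset.sum_eq_zero_iff_of_nonneg fun e _ =>
    div_nonneg (mul_self_nonneg _) (Γ.length_pos e).le] at henergy
  refine Γ.eq_of_forall_src_eq_tgt (fun e => sub_eq_zero.1 ?_) u v
  simpa [(Γ.length_pos e).ne'] using henergy e (Finset.mem_univ e)

variable (Γ) in
open Classical in
/-- `G v u` is the potential at the vertex `u` when a unit current enters at the vertex `v` and
exits at the grounded vertex `o`. -/
structure IsGroundedGreen [Fintype E] (o : V) (G : V → V → ℝ) : Prop where
  vertexLaplacian_eq (v : V) : Γ.vertexLaplacian (G v) = Pi.single v 1 - Pi.single o 1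
  map_ground (v : V) : G v o = 0

theorem IsGroundedGreen.symm [Fintype E] {o : V} {G : V → V → ℝ} (hG : Γ.IsGroundedGreen o G)
    (u v : V) : G u v = G v u := by
  have := Γ.finite_vertices
  have := Fintype.ofFinite V
  classical
  have hpair (u v : V) : G u ⬝ᵥ Γ.vertexLaplacian (G v) = G u v := by
    simp [hG.vertexLaplacian_eq, dotProduct_sub, hG.map_ground]
  rw [← hpair u v, dotProduct_vertexLaplacian_comm, hpair]

variable (Γ) in
theorem exists_isGroundedGreen [Fintype E] (o : V) : ∃ G, Γ.IsGroundedGreen o G := by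
  classical
  have := Γ.finite_vertices
  have := Fintype.ofFinite V
  let T : (V → ℝ) →ₗ[ℝ] V → ℝ :=
    Γ.vertexLaplacian + (LinearMap.proj o).smulRight (Pi.single o 1)
  have hT (h : V → ℝ) : T h = Γ.vertexLaplacian h + h o • Pi.single o 1 := rfl
  have hground (h : V → ℝ) : 1 ⬝ᵥ T h = h o := by
    rw [hT, dotProduct_add, one_dotProduct_vertexLaplacian, dotProduct_smul, dotProduct_single_one]
    simp
  have hinj : Function.Injective T := by
    refine (injective_iff_map_eq_zero T).2 fun h hh => ?_
    have ho : h o = 0 := by rw [← hground h, hh, dotProduct_zero]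
    have hΔ : Γ.vertexLaplacian h = 0 := by rw [← hh, hT, ho, zero_smul, add_zero]
    exact funext fun v => (eq_of_vertexLaplacian_eq_zero hΔ v o).trans ho
  choose G hG using fun v => LinearMap.injective_iff_surjective.1 hinj
    (Pi.single v 1 - Pi.single o 1)
  have hGo (v : V) : G v o = 0 := by
    rw [← hground (G v), hG, dotProduct_sub, dotProduct_single_one, dotProduct_single_one]
    simp
  refine ⟨G, fun v => ?_, hGo⟩
  rw [← add_zero (Γ.vertexLaplacian (G v)), ← zero_smul ℝ (Pi.single o (1 : ℝ)), ← hGo v, ← hT, hG]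

/-! ### Affine interpolation -/

variable (Γ) in
/-- The function on `Γ` that is affine on the edges and equal to `h` at the vertices. -/
def interpolate : (V → ℝ) →ₗ[ℝ] Γ.Point → ℝ where
  toFun h := Point.lift h
    (fun e t => h (Γ.src e) + (t : ℝ) / Γ.length e * (h (Γ.tgt e) - h (Γ.src e)))
    (by simp) (fun e => by simp [(Γ.length_pos e).ne'])
  map_add' h k := by
    ext x
    induction x using point_cases with
    | vertex v => rfl
    | edge e t =>
      change h _ + k _ + _ / _ * (h _ + k _ - (h _ + k _)) =
        h _ + _ / _ * (h _ - h _) + (k _ + _ / _ * (k _ - k _))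
      ring
  map_smul' c h := by
    ext x
    induction x using point_cases with
    | vertex v => rfl
    | edge e t =>
      change c * h _ + _ / _ * (c * h _ - c * h _) = c * (h _ + _ / _ * (h _ - h _))
      ring

@[simp]
theorem interpolate_vertex (h : V → ℝ) (v : V) : Γ.interpolate h (Γ.vertex v) = h v := rfl

theorem interpolate_edgePoint (h : V → ℝ) (e : E) (t : Icc (0 : ℝ) (Γ.length e)) :
    Γ.interpolate h (Γ.edgePoint e t) =
      h (Γ.src e) + (t : ℝ) / Γ.length e * (h (Γ.tgt e) - h (Γ.src e)) := rfl

theorem interpolate_const (c : ℝ) (x : Γ.Point) : Γ.interpolate (fun _ => c) x = c := by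
  induction x using point_cases with
  | vertex v => rfl
  | edge e t => simp [interpolate_edgePoint]

theorem map_interpolate {ι κ : Type*} (T : (ι → ℝ) →ₗ[ℝ] κ → ℝ) (K : V → ι → ℝ) (y : Γ.Point) :
    T (fun i => Γ.interpolate (fun v => K v i) y) =
      fun j => Γ.interpolate (fun v => T (K v) j) y := by
  induction y using point_cases with
  | vertex v => rfl
  | edge e t =>
    have hK : (fun i => Γ.interpolate (fun v => K v i) (Γ.edgePoint e t)) =
        K (Γ.src e) + ((t : ℝ) / Γ.length e) • (K (Γ.tgt e) - K (Γ.src e)) := rfl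
    rw [hK, map_add, map_smul, map_sub]
    rfl

theorem interpolate_comm (K : V → V → ℝ) (x y : Γ.Point) :
    Γ.interpolate (fun u => Γ.interpolate (fun v => K v u) y) x =
      Γ.interpolate (fun v => Γ.interpolate (K v) x) y :=
  congrFun (map_interpolate Γ.interpolate K y) x

theorem continuous_interpolate (h : V → ℝ) : Continuous (Γ.interpolate h) :=
  continuous_of_continuous_edgePoint fun e => by
    simp only [interpolate_edgePoint]
    fun_prop

theorem hasSlopeOn_interpolate (h : V → ℝ) (e : E) :
    HasSlopeOn (Γ.interpolate h) e 0 (Γ.length e) ((h (Γ.tgt e) - h (Γ.src e)) / Γ.length e) :=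
  ⟨h (Γ.src e), fun t ht => by rw [onEdge_apply _ e ht, interpolate_edgePoint]; ring⟩

theorem isPiecewiseAffine_interpolate (h : V → ℝ) : IsPiecewiseAffine (Γ.interpolate h) :=
  fun e => ⟨∅, fun _ _ ha _ hb _ => ⟨_, (hasSlopeOn_interpolate h e).mono ha hb⟩⟩

theorem laplacianEdge_interpolate (h : V → ℝ) (e : E) {t : ℝ} (h0 : 0 < t)
    (h1 : t < Γ.length e) : laplacianEdge (Γ.interpolate h) e t = 0 :=
  (hasSlopeOn_interpolate h e).laplacianEdge_eq_zero ⟨h0, h1⟩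

theorem laplacianVertex_interpolate [Fintype E] (h : V → ℝ) (v : V) :
    laplacianVertex (Γ.interpolate h) v = Γ.vertexLaplacian h v := by
  simp only [laplacianVertex, (hasSlopeOn_interpolate h _).slopeForward_eq (Γ.length_pos _),
    (hasSlopeOn_interpolate h _).slopeBackward_eq (Γ.length_pos _), vertexLaplacian_apply,
    Finset.sum_apply, Pi.smul_apply, Pi.sub_apply, Pi.single_apply,
    smul_eq_mul, ← Finset.sum_neg_distrib]
  refine Finset.sum_congr rfl fun e _ => ?_
  grind

theorem IsPiecewiseAffine.eq_interpolate {f : Γ.Point → ℝ} (hf : IsPiecewiseAffine f)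
    (hΔ : ∀ e t, 0 < t → t < Γ.length e → laplacianEdge f e t = 0) :
    f = Γ.interpolate fun v => f (Γ.vertex v) := by
  funext x
  induction x using point_cases with
  | vertex v => rfl
  | edge e t =>
    obtain ⟨m, c, hc⟩ := hf.exists_hasSlopeOn_of_laplacianEdge_eq_zero (hΔ e)
    have hL := Γ.length_pos e
    rw [interpolate_edgePoint, ← onEdge_zero f, ← onEdge_length f, ← onEdge_apply f e t.2, hc _ t.2,
      hc _ (left_mem_Icc.2 hL.le), hc _ (right_mem_Icc.2 hL.le)]
    field_simp
    ring

theorem IsPiecewiseAffine.eq_of_laplacian_eq_zero [Fintype E] {f : Γ.Point → ℝ}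
    (hf : IsPiecewiseAffine f) (hV : ∀ v, laplacianVertex f v = 0)
    (hE : ∀ e t, 0 < t → t < Γ.length e → laplacianEdge f e t = 0) (x y : Γ.Point) :
    f x = f y := by
  have hfi := hf.eq_interpolate hE
  have hconst := eq_of_vertexLaplacian_eq_zero (Γ := Γ) (h := fun v => f (Γ.vertex v)) <|
    funext fun v => by rw [← laplacianVertex_interpolate, ← hfi, hV, Pi.zero_apply]
  obtain ⟨o⟩ := Γ.nonempty
  rw [hfi, funext fun v => hconst v o, interpolate_const, interpolate_const]

/-! ### The Green function of the edges -/

open Classical in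
/-- `edgeGreen y` is the potential in the edge containing `y` when a unit current enters at `y` and
both end points of the edge are grounded, extended by `0` to the other edges. -/
def edgeGreen : Γ.Point → Γ.Point → ℝ :=
  Point.lift (fun _ _ => 0)
    (fun e s => Point.lift (fun _ => 0)
      (fun e' t => if e = e' then min (s : ℝ) t - (s : ℝ) * t / Γ.length e else 0)
      (fun e' => by simp [s.2.1])
      (fun e' => by
        split_ifs with h
        · subst h
          simp [s.2.2, (Γ.length_pos e).ne']
        · rfl))
    (fun e => funext fun x => by
      induction x using point_cases with
      | vertex v => rfl
      | edge e' t h0 _ => exact ite_eq_right_iff.2 fun _ => by simp [h0.le])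
    (fun e => funext fun x => by
      induction x using point_cases with
      | vertex v => rfl
      | edge e' t h0 h1 =>
        refine ite_eq_right_iff.2 fun h => ?_
        subst h
        simp [h1.le, (Γ.length_pos e).ne'])

@[simp]
theorem edgeGreen_vertex_left (v : V) : edgeGreen (Γ.vertex v) = 0 := rfl

theorem edgeGreen_edgePoint_self (e : E) (s t : Icc (0 : ℝ) (Γ.length e)) :
    edgeGreen (Γ.edgePoint e s) (Γ.edgePoint e t) =
      min (s : ℝ) t - (s : ℝ) * t / Γ.length e :=
  if_pos rfl

theorem edgeGreen_edgePoint_of_ne {e e' : E} (h : e ≠ e') (s : Icc (0 : ℝ) (Γ.length e))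
    (t : Icc (0 : ℝ) (Γ.length e')) :
    edgeGreen (Γ.edgePoint e s) (Γ.edgePoint e' t) = 0 :=
  if_neg h

@[simp]
theorem edgeGreen_vertex_right (y : Γ.Point) (v : V) : edgeGreen y (Γ.vertex v) = 0 := by
  induction y using point_cases <;> rfl

theorem edgeGreen_comm (x y : Γ.Point) : edgeGreen x y = edgeGreen y x := by
  induction x using point_cases with
  | vertex v => simp
  | edge e s =>
  induction y using point_cases with
  | vertex v => simp
  | edge e' t =>
    rcases eq_or_ne e e' with rfl | h
    · rw [edgeGreen_edgePoint_self, edgeGreen_edgePoint_self, min_comm, mul_comm (s : ℝ)]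
    · rw [edgeGreen_edgePoint_of_ne h, edgeGreen_edgePoint_of_ne h.symm]

theorem edgeGreen_vertex_eq_interpolate_zero (v : V) :
    edgeGreen (Γ.vertex v) = Γ.interpolate 0 := by
  rw [edgeGreen_vertex_left, map_zero]

section EdgeGreen

variable (e : E) (s : Icc (0 : ℝ) (Γ.length e))

theorem hasSlopeOn_edgeGreen_left :
    HasSlopeOn (edgeGreen (Γ.edgePoint e s)) e 0 s (1 - s / Γ.length e) :=
  ⟨0, fun t ht => by
    rw [onEdge_apply _ e ⟨ht.1, ht.2.trans s.2.2⟩, edgeGreen_edgePoint_self, min_eq_right ht.2]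
    ring⟩

theorem hasSlopeOn_edgeGreen_right :
    HasSlopeOn (edgeGreen (Γ.edgePoint e s)) e s (Γ.length e) (-(s / Γ.length e)) :=
  ⟨s, fun t ht => by
    rw [onEdge_apply _ e ⟨s.2.1.trans ht.1, ht.2⟩, edgeGreen_edgePoint_self, min_eq_left ht.1]
    ring⟩

theorem hasSlopeOn_edgeGreen_of_ne {e' : E} (h : e ≠ e') (a b : ℝ) :
    HasSlopeOn (edgeGreen (Γ.edgePoint e s)) e' a b 0 :=
  ⟨0, fun t _ => by rw [onEdge, edgeGreen_edgePoint_of_ne h, zero_mul, add_zero]⟩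

end EdgeGreen

theorem continuous_edgeGreen (y : Γ.Point) : Continuous (edgeGreen y) := by
  induction y using point_cases with
  | vertex => exact continuous_zero
  | edge e s =>
    refine continuous_of_continuous_edgePoint fun e' => ?_
    rcases eq_or_ne e e' with rfl | h
    · simp only [edgeGreen_edgePoint_self]
      fun_prop
    · simp only [edgeGreen_edgePoint_of_ne h]
      fun_prop

theorem isPiecewiseAffine_edgeGreen (y : Γ.Point) : IsPiecewiseAffine (edgeGreen y) := by
  induction y using point_cases with
  | vertex =>
    rw [edgeGreen_vertex_eq_interpolate_zero]
    exact isPiecewiseAffine_interpolate 0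
  | edge e s =>
    intro e'
    rcases eq_or_ne e e' with rfl | h
    · refine ⟨{(s : ℝ)}, fun a b ha _ hb hs => ?_⟩
      rcases le_or_gt b s with hbs | hbs
      · exact ⟨_, (hasSlopeOn_edgeGreen_left e s).mono ha hbs⟩
      · exact ⟨_, (hasSlopeOn_edgeGreen_right e s).mono
          (le_of_not_gt fun has => hs s (Finset.mem_singleton_self _) ⟨has, hbs⟩) hb⟩
    · exact ⟨∅, fun a b _ _ _ _ => ⟨0, hasSlopeOn_edgeGreen_of_ne e s h a b⟩⟩

theorem laplacianEdge_edgeGreen (y : Γ.Point) (e : E) (t : Icc (0 : ℝ) (Γ.length e))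
    (h0 : 0 < (t : ℝ)) (h1 : (t : ℝ) < Γ.length e) :
    laplacianEdge (edgeGreen y) e t = unitMass y (Γ.edgePoint e t) := by
  induction y using point_cases with
  | vertex v =>
    rw [edgeGreen_vertex_eq_interpolate_zero, laplacianEdge_interpolate _ _ h0 h1, unitMass,
      if_neg (edgePoint_ne_vertex h0 h1 v)]
  | edge e' s hs0 hs1 =>
    classical
    rw [unitMass, if_congr (edgePoint_eq_iff h0 h1 hs0 hs1) rfl rfl]
    rcases eq_or_ne e' e with rfl | h
    · have hleft := hasSlopeOn_edgeGreen_left e' s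
      have hright := hasSlopeOn_edgeGreen_right e' s
      rcases lt_trichotomy (t : ℝ) s with hts | hts | hts
      · simp [hleft.laplacianEdge_eq_zero ⟨h0, hts⟩, hts.ne]
      · simp [hts, hleft.laplacianEdge_eq hright hs0 hs1]
      · simp [hright.laplacianEdge_eq_zero ⟨hts, h1⟩, hts.ne']
    · simp [(hasSlopeOn_edgeGreen_of_ne e' s h _ _).laplacianEdge_eq_zero ⟨h0, h1⟩, h.symm]

open Classical in
theorem laplacianVertex_edgeGreen [Fintype E] (y : Γ.Point) (v : V) :
    laplacianVertex (edgeGreen y) v =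
      unitMass y (Γ.vertex v) - Γ.interpolate (Pi.single v 1) y := by
  induction y using point_cases with
  | vertex w =>
    rw [edgeGreen_vertex_eq_interpolate_zero, laplacianVertex_interpolate, map_zero, unitMass,
      vertex_injective.eq_iff, interpolate_vertex, Pi.single_apply, Pi.zero_apply]
    grind
  | edge e s h0 h1 =>
    rw [laplacianVertex, unitMass, if_neg (edgePoint_ne_vertex h0 h1 v).symm,
      interpolate_edgePoint, Finset.sum_eq_single e]
    · rw [(hasSlopeOn_edgeGreen_left e s).slopeForward_eq h0,
        (hasSlopeOn_edgeGreen_right e s).slopeBackward_eq h1, Pi.single_apply, Pi.single_apply]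
      split_ifs <;> ring
    · intro e' _ h
      have hslope := hasSlopeOn_edgeGreen_of_ne e s h.symm 0 (Γ.length e')
      simp [hslope.slopeForward_eq (Γ.length_pos e'), hslope.slopeBackward_eq (Γ.length_pos e')]
    · simp

/-! ### The voltage function -/

/-- The potential with source `y` that extends the potentials `G` between the vertices. -/
def greenKernel (G : V → V → ℝ) (y : Γ.Point) : Γ.Point → ℝ :=
  Γ.interpolate (fun u => Γ.interpolate (fun v => G v u) y) + edgeGreen y

theorem greenKernel_apply (G : V → V → ℝ) (y x : Γ.Point) :
    greenKernel G y x =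
      Γ.interpolate (fun u => Γ.interpolate (fun v => G v u) y) x + edgeGreen y x := rfl

theorem isPiecewiseAffine_greenKernel (G : V → V → ℝ) (y : Γ.Point) :
    IsPiecewiseAffine (greenKernel G y) :=
  (isPiecewiseAffine_interpolate _).add (isPiecewiseAffine_edgeGreen y)

theorem laplacianEdge_greenKernel (G : V → V → ℝ) (y : Γ.Point) (e : E)
    (t : Icc (0 : ℝ) (Γ.length e)) (h0 : 0 < (t : ℝ)) (h1 : (t : ℝ) < Γ.length e) :
    laplacianEdge (greenKernel G y) e t = unitMass y (Γ.edgePoint e t) := by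
  rw [greenKernel, (isPiecewiseAffine_interpolate _).laplacianEdge_add
    (isPiecewiseAffine_edgeGreen y) h0 h1, laplacianEdge_interpolate _ e h0 h1,
    laplacianEdge_edgeGreen y e t h0 h1, zero_add]

section Voltage

variable [Fintype E] {o : V} {G : V → V → ℝ}

open Classical in
theorem IsGroundedGreen.laplacianVertex_greenKernel (hG : Γ.IsGroundedGreen o G) (y : Γ.Point)
    (v : V) : laplacianVertex (greenKernel G y) v =
      unitMass y (Γ.vertex v) - (Pi.single o 1 : V → ℝ) v := by
  have hsource : (fun u => Γ.vertexLaplacian (G u) v) =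
      Pi.single v 1 - fun _ => (Pi.single o 1 : V → ℝ) v := by
    ext u
    simp only [hG.vertexLaplacian_eq, Pi.sub_apply, Pi.single_apply]
    grind
  rw [greenKernel, (isPiecewiseAffine_interpolate _).laplacianVertex_add
    (isPiecewiseAffine_edgeGreen y), laplacianVertex_interpolate, laplacianVertex_edgeGreen,
    map_interpolate Γ.vertexLaplacian]
  simp only [hsource, map_sub, Pi.sub_apply, interpolate_const]
  ring

theorem IsGroundedGreen.greenKernel_comm (hG : Γ.IsGroundedGreen o G) (x y : Γ.Point) :
    greenKernel G x y = greenKernel G y x := by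
  rw [greenKernel_apply, greenKernel_apply, interpolate_comm, edgeGreen_comm]
  simp only [hG.symm]

theorem IsGroundedGreen.isPotential (hG : Γ.IsGroundedGreen o G) (z y : Γ.Point) :
    IsPotential z y (greenKernel G y - greenKernel G z -
      Γ.interpolate fun _ => greenKernel G y z - greenKernel G z z) where
  piecewiseAffine := ((isPiecewiseAffine_greenKernel G y).sub
    (isPiecewiseAffine_greenKernel G z)).sub (isPiecewiseAffine_interpolate _)
  laplacian_vertex v := by
    have hconst (c : ℝ) : Γ.vertexLaplacian (fun _ => c) = 0 := by simp [vertexLaplacian_apply]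
    have hyz := (isPiecewiseAffine_greenKernel G y).sub (isPiecewiseAffine_greenKernel G z)
    rw [hyz.laplacianVertex_sub (isPiecewiseAffine_interpolate _),
      (isPiecewiseAffine_greenKernel G y).laplacianVertex_sub (isPiecewiseAffine_greenKernel G z),
      hG.laplacianVertex_greenKernel, hG.laplacianVertex_greenKernel, laplacianVertex_interpolate,
      hconst, Pi.zero_apply]
    ring
  laplacian_edge e t h0 h1 := by
    have hyz := (isPiecewiseAffine_greenKernel G y).sub (isPiecewiseAffine_greenKernel G z)
    rw [hyz.laplacianEdge_sub (isPiecewiseAffine_interpolate _) h0 h1,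
      (isPiecewiseAffine_greenKernel G y).laplacianEdge_sub (isPiecewiseAffine_greenKernel G z)
        h0 h1, laplacianEdge_greenKernel G y e t h0 h1, laplacianEdge_greenKernel G z e t h0 h1,
      laplacianEdge_interpolate _ e h0 h1, sub_zero]
  map_ground := by simp [interpolate_const]

theorem IsPotential.unique {z y : Γ.Point} {f g : Γ.Point → ℝ} (hf : IsPotential z y f)
    (hg : IsPotential z y g) : f = g := by
  have hf' := hf.piecewiseAffine
  have hg' := hg.piecewiseAffine
  funext x
  have hconst := (hf'.sub hg').eq_of_laplacian_eq_zero (fun v => by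
      rw [hf'.laplacianVertex_sub hg', hf.laplacian_vertex, hg.laplacian_vertex, sub_self])
    (fun e t h0 h1 => by
      rw [hf'.laplacianEdge_sub hg' h0 h1, hf.laplacian_edge e ⟨t, h0.le, h1.le⟩ h0 h1,
        hg.laplacian_edge e ⟨t, h0.le, h1.le⟩ h0 h1, sub_self]) x z
  simpa [hf.map_ground, hg.map_ground, sub_eq_zero] using hconst

theorem IsGroundedGreen.voltage_eq (hG : Γ.IsGroundedGreen o G) (z x y : Γ.Point) :
    voltage z x y = greenKernel G y x - greenKernel G z x -
      (greenKernel G y z - greenKernel G z z) := by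
  have h := hG.isPotential z y
  rw [voltage, (Classical.epsilon_spec (p := IsPotential z y) ⟨_, h⟩).unique h, Pi.sub_apply,
    Pi.sub_apply, interpolate_const]

theorem IsGroundedGreen.resistance_eq (hG : Γ.IsGroundedGreen o G) (x y : Γ.Point) :
    resistance x y = greenKernel G x x + greenKernel G y y - 2 * greenKernel G x y := by
  rw [resistance, hG.voltage_eq, hG.greenKernel_comm y x]
  ring

theorem resistance_comm (x y : Γ.Point) : resistance x y = resistance y x := by
  obtain ⟨o⟩ := Γ.nonempty
  obtain ⟨G, hG⟩ := exists_isGroundedGreen Γ o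
  rw [hG.resistance_eq, hG.resistance_eq, hG.greenKernel_comm y x]
  ring

theorem resistance_self (x : Γ.Point) : resistance x x = 0 := by
  obtain ⟨o⟩ := Γ.nonempty
  obtain ⟨G, hG⟩ := exists_isGroundedGreen Γ o
  rw [hG.resistance_eq]
  ring

theorem voltage_eq_resistance (z x y : Γ.Point) :
    voltage z x y = (resistance x z + resistance y z - resistance x y) / 2 := by
  obtain ⟨o⟩ := Γ.nonempty
  obtain ⟨G, hG⟩ := exists_isGroundedGreen Γ o
  rw [hG.voltage_eq, hG.resistance_eq, hG.resistance_eq, hG.resistance_eq, hG.greenKernel_comm y x,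
    hG.greenKernel_comm x z]
  ring

end Voltage

/-! ### The resistance function on the edges -/

section Resistance

variable [Fintype E]

variable (Γ) in
/-- The density of the canonical measure on the edge `e`. -/
def edgeDensity (e : E) : ℝ :=
  (Γ.length e - resistance (Γ.startPoint e) (Γ.endPoint e)) / Γ.length e ^ 2

variable (Γ) in
/-- The function that vanishes at the vertices and is quadratic on every edge `e`, with second
derivative `-2 * edgeDensity e`. -/
def edgeParabola : Γ.Point → ℝ :=
  Point.lift 0 (fun e s => Γ.edgeDensity e * (s * (Γ.length e - s))) (by simp) (by simp)

theorem edgeParabola_vertex (v : V) : Γ.edgeParabola (Γ.vertex v) = 0 := rfl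

theorem edgeParabola_edgePoint (e : E) (s : Icc (0 : ℝ) (Γ.length e)) :
    Γ.edgeParabola (Γ.edgePoint e s) = Γ.edgeDensity e * (s * (Γ.length e - s)) := rfl

theorem continuous_edgeParabola : Continuous (Γ.edgeParabola) :=
  continuous_of_continuous_edgePoint fun e => by
    simp only [edgeParabola_edgePoint]
    fun_prop

section GroundedGreen

variable {o : V} {G : V → V → ℝ} (hG : Γ.IsGroundedGreen o G)
include hG

theorem IsGroundedGreen.resistance_vertex (u v : V) :
    resistance (Γ.vertex u) (Γ.vertex v) = G u u + G v v - 2 * G u v := by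
  simp [hG.resistance_eq, greenKernel_apply]

theorem IsGroundedGreen.greenKernel_self (x : Γ.Point) :
    greenKernel G x x = Γ.interpolate (fun v => G v v) x + Γ.edgeParabola x := by
  induction x using point_cases with
  | vertex v => simp [greenKernel_apply, edgeParabola_vertex]
  | edge e s =>
    have := (Γ.length_pos e).ne'
    simp only [greenKernel_apply, edgeGreen_edgePoint_self, edgeParabola_edgePoint, edgeDensity,
      startPoint, endPoint, hG.resistance_vertex, interpolate_edgePoint, min_self,
      hG.symm (Γ.tgt e) (Γ.src e)]
    field_simp
    ring

end GroundedGreen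

theorem resistance_eq_interpolate (x y : Γ.Point) :
    resistance x y =
      Γ.interpolate (fun u => Γ.interpolate (fun v => resistance (Γ.vertex u) (Γ.vertex v)) x) y +
        Γ.edgeParabola x + Γ.edgeParabola y - 2 * edgeGreen x y := by
  obtain ⟨o⟩ := Γ.nonempty
  obtain ⟨G, hG⟩ := exists_isGroundedGreen Γ o
  let d : V → ℝ := fun v => G v v
  have hinner (u : V) : Γ.interpolate (fun v => resistance (Γ.vertex u) (Γ.vertex v)) x =
      G u u + Γ.interpolate d x - 2 * Γ.interpolate (fun v => G v u) x := by
    have hr : (fun v => resistance (Γ.vertex u) (Γ.vertex v)) =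
        (fun _ => G u u) + d - (2 : ℝ) • fun v => G v u :=
      funext fun v => by simp [hG.resistance_vertex, hG.symm u v, d]
    rw [hr]
    simp [interpolate_const]
  have houter : (fun u => G u u + Γ.interpolate d x - 2 * Γ.interpolate (fun v => G v u) x) =
      d + (fun _ => Γ.interpolate d x) - (2 : ℝ) • fun u => Γ.interpolate (fun v => G v u) x := rfl
  simp only [hinner]
  rw [houter, hG.resistance_eq, hG.greenKernel_self, hG.greenKernel_self, greenKernel_apply]
  simp [interpolate_const, d]
  ring

theorem continuous_resistance (x : Γ.Point) : Continuous (resistance x) := by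
  simp only [funext (resistance_eq_interpolate x)]
  exact (((continuous_interpolate _).add continuous_const).add continuous_edgeParabola).sub
    (continuous_const.mul (continuous_edgeGreen x))

theorem resistance_edgePoint_of_ne {i j : E} (h : i ≠ j) (x : Icc (0 : ℝ) (Γ.length i))
    (y : Icc (0 : ℝ) (Γ.length j)) :
    resistance (Γ.edgePoint i x) (Γ.edgePoint j y) =
      (1 - x / Γ.length i) * (1 - y / Γ.length j) * resistance (Γ.startPoint i) (Γ.startPoint j) +
      x / Γ.length i * (1 - y / Γ.length j) * resistance (Γ.endPoint i) (Γ.startPoint j) +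
      (1 - x / Γ.length i) * (y / Γ.length j) * resistance (Γ.startPoint i) (Γ.endPoint j) +
      x / Γ.length i * (y / Γ.length j) * resistance (Γ.endPoint i) (Γ.endPoint j) +
      Γ.edgeDensity i * (x * (Γ.length i - x)) + Γ.edgeDensity j * (y * (Γ.length j - y)) := by
  rw [resistance_eq_interpolate, edgeGreen_edgePoint_of_ne h]
  simp only [interpolate_edgePoint, edgeParabola_edgePoint, startPoint, endPoint,
    resistance_comm _ (Γ.vertex (Γ.src i)),
    resistance_comm _ (Γ.vertex (Γ.tgt i))]
  ring

theorem resistance_edgePoint_self (e : E) (x y : Icc (0 : ℝ) (Γ.length e)) :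
    resistance (Γ.edgePoint e x) (Γ.edgePoint e y) =
      |(x : ℝ) - y| - ((x : ℝ) - y) ^ 2 * Γ.edgeDensity e := by
  have hL := (Γ.length_pos e).ne'
  have habs : |(x : ℝ) - y| = x + y - 2 * min (x : ℝ) y := by
    linarith [min_add_max (x : ℝ) y, max_sub_min_eq_abs' (x : ℝ) y]
  rw [resistance_eq_interpolate, edgeGreen_edgePoint_self, habs]
  simp only [interpolate_edgePoint, edgeParabola_edgePoint, edgeDensity, startPoint, endPoint,
    resistance_self, resistance_comm (Γ.vertex (Γ.tgt e)) (Γ.vertex (Γ.src e))]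
  field_simp
  ring

end Resistance

/-! ### Integration against signed measures -/

instance {X : Type*} [MeasurableSpace X] (μ : SignedMeasure X) : IsFiniteMeasure μ.variation := by
  rw [← SignedMeasure.totalVariation_eq_variation]
  infer_instance

theorem integrable_of_continuous [Finite E] (μ : SignedMeasure Γ.Point) {f : Γ.Point → ℝ}
    (hf : Continuous f) : μ.Integrable f :=
  let ⟨C, hC⟩ := isCompact_univ.exists_bound_of_continuousOn hf.continuousOn
  Integrable.of_bound hf.measurable.aestronglyMeasurable C (.of_forall fun x => hC x (mem_univ x))

theorem signedIntegral_const {X : Type*} [MeasurableSpace X] (μ : SignedMeasure X) (c : ℝ) :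
    ∫ᵛ _, c ∂<•μ = μ univ * c := by
  simp [VectorMeasure.integral_const]

theorem signedIntegral_const_mul {X : Type*} [MeasurableSpace X] (μ : SignedMeasure X) (c : ℝ)
    (f : X → ℝ) : ∫ᵛ x, c * f x ∂<•μ = c * ∫ᵛ x, f x ∂<•μ :=
  VectorMeasure.integral_fun_smul μ _ c f

variable (Γ) in
/-- Lebesgue measure on the edge `e`, as a measure on the graph. -/
def edgeMeasure (e : E) : Measure Γ.Point :=
  (volume.restrict (Icc 0 (Γ.length e))).map
    fun t => Γ.edgePoint e (projIcc 0 (Γ.length e) (Γ.length_pos e).le t)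

theorem continuous_edgePoint_projIcc (e : E) :
    Continuous fun t => Γ.edgePoint e (projIcc 0 (Γ.length e) (Γ.length_pos e).le t) :=
  (continuous_edgePoint e).comp continuous_projIcc

instance (e : E) : IsFiniteMeasure (Γ.edgeMeasure e) := by
  unfold edgeMeasure
  infer_instance

theorem integral_edgeMeasure (e : E) {f : Γ.Point → ℝ} (hf : Continuous f) :
    ∫ x, f x ∂(Γ.edgeMeasure e) = ∫ t in (0 : ℝ)..Γ.length e, onEdge f e t := by
  rw [edgeMeasure, integral_map (continuous_edgePoint_projIcc e).measurable.aemeasurable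
    hf.measurable.aestronglyMeasurable, intervalIntegral.integral_of_le (Γ.length_pos e).le,
    integral_Icc_eq_integral_Ioc]
  rfl

theorem HasSlopeOn.integral_onEdge {f : Γ.Point → ℝ} {e : E} {a b m : ℝ}
    (h : HasSlopeOn f e a b m) (hab : a ≤ b) :
    ∫ t in a..b, onEdge f e t = (b - a) * (onEdge f e a + onEdge f e b) / 2 := by
  obtain ⟨c, hc⟩ := h
  have haffine : ∫ t in a..b, onEdge f e t = ∫ t in a..b, (m * t + c) :=
    intervalIntegral.integral_congr fun t ht => hc t (uIcc_of_le hab ▸ ht)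
  rw [haffine, intervalIntegral.integral_add (Continuous.intervalIntegrable (by fun_prop) _ _)
    (Continuous.intervalIntegrable (by fun_prop) _ _), intervalIntegral.integral_const_mul,
    integral_id, intervalIntegral.integral_const, smul_eq_mul, hc a (left_mem_Icc.2 hab),
    hc b (right_mem_Icc.2 hab)]
  ring

theorem integral_onEdge_interpolate (h : V → ℝ) (e : E) :
    ∫ t in (0 : ℝ)..Γ.length e, onEdge (Γ.interpolate h) e t =
      Γ.length e * (h (Γ.src e) + h (Γ.tgt e)) / 2 := by
  rw [(hasSlopeOn_interpolate h e).integral_onEdge (Γ.length_pos e).le, onEdge_zero, onEdge_length,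
    interpolate_vertex, interpolate_vertex, sub_zero]

theorem integral_onEdge_edgeGreen_self (e : E) (s : Icc (0 : ℝ) (Γ.length e)) :
    ∫ t in (0 : ℝ)..Γ.length e, onEdge (edgeGreen (Γ.edgePoint e s)) e t =
      s * (Γ.length e - s) / 2 := by
  have hcont : Continuous (onEdge (edgeGreen (Γ.edgePoint e s)) e) :=
    (continuous_edgeGreen _).comp (continuous_edgePoint_projIcc e)
  have hL := (Γ.length_pos e).ne'
  rw [← intervalIntegral.integral_add_adjacent_intervals (hcont.intervalIntegrable 0 s)
    (hcont.intervalIntegrable s _), (hasSlopeOn_edgeGreen_left e s).integral_onEdge s.2.1,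
    (hasSlopeOn_edgeGreen_right e s).integral_onEdge s.2.2, onEdge_zero, onEdge_length,
    onEdge_apply _ e s.2, edgeGreen_edgePoint_self]
  simp only [edgeGreen_vertex_right, min_self]
  field_simp
  ring

theorem integral_onEdge_edgeGreen_of_ne {e e' : E} (h : e ≠ e') (s : Icc (0 : ℝ) (Γ.length e)) :
    ∫ t in (0 : ℝ)..Γ.length e', onEdge (edgeGreen (Γ.edgePoint e s)) e' t = 0 := by
  rw [(hasSlopeOn_edgeGreen_of_ne e s h _ _).integral_onEdge (Γ.length_pos e').le, onEdge_zero,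
    onEdge_length, edgeGreen_vertex_right, edgeGreen_vertex_right, add_zero, mul_zero, zero_div]

variable (Γ) in
/-- The error of the trapezoidal rule on the edge `e`, as a signed measure: integration over the
edge minus the point masses that give the same integral to affine functions. -/
def trapezoidError (e : E) : SignedMeasure Γ.Point :=
  (Γ.edgeMeasure e).toSignedMeasure - (Γ.length e / 2) •
    ((Measure.dirac (Γ.startPoint e)).toSignedMeasure +
      (Measure.dirac (Γ.endPoint e)).toSignedMeasure)

section Integral

variable {f : Γ.Point → ℝ} (hf : Continuous f)
include hf

theorem signedIntegral_dirac (x : Γ.Point) :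
    ∫ᵛ z, f z ∂<•(Measure.dirac x).toSignedMeasure = f x := by
  rw [VectorMeasure.integral_toSignedMeasure, integral_dirac' _ _ hf.measurable.stronglyMeasurable]

theorem integral_trapezoidError [Finite E] (e : E) :
    ∫ᵛ z, f z ∂<•(Γ.trapezoidError e) = (∫ t in (0 : ℝ)..Γ.length e, onEdge f e t) -
      Γ.length e * (f (Γ.startPoint e) + f (Γ.endPoint e)) / 2 := by
  have hint (μ : SignedMeasure Γ.Point) := integrable_of_continuous μ hf
  rw [trapezoidError, VectorMeasure.integral_sub_vectorMeasure (hint _) (hint _),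
    VectorMeasure.integral_smul_vectorMeasure,
    VectorMeasure.integral_add_vectorMeasure (hint _) (hint _), signedIntegral_dirac hf,
    signedIntegral_dirac hf, VectorMeasure.integral_toSignedMeasure, integral_edgeMeasure e hf,
    smul_eq_mul]
  ring

end Integral

/-! ### The canonical measure -/

variable (Γ) in
/-- The signed measure with mass `b v` at the vertex `v`, corrected on every edge `e` by
`edgeDensity e` times the trapezoidal error, which does not change the integral of functions that
are affine on the edges. -/
def vertexWeightMeasure [Fintype V] [Fintype E] (b : V → ℝ) : SignedMeasure Γ.Point :=
  ∑ v, b v • (Measure.dirac (Γ.vertex v)).toSignedMeasure +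
    ∑ e, Γ.edgeDensity e • Γ.trapezoidError e

section VertexWeightMeasure

variable [Fintype V] [Fintype E] (b : V → ℝ)

theorem integral_vertexWeightMeasure {f : Γ.Point → ℝ} (hf : Continuous f) :
    ∫ᵛ z, f z ∂<•(Γ.vertexWeightMeasure b) = b ⬝ᵥ (fun v => f (Γ.vertex v)) +
      ∑ e, Γ.edgeDensity e * ((∫ t in (0 : ℝ)..Γ.length e, onEdge f e t) -
        Γ.length e * (f (Γ.startPoint e) + f (Γ.endPoint e)) / 2) := by
  have hint (μ : SignedMeasure Γ.Point) := integrable_of_continuous μ hf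
  rw [vertexWeightMeasure, VectorMeasure.integral_add_vectorMeasure (hint _) (hint _),
    VectorMeasure.integral_finsetSum_vectorMeasure fun _ _ => hint _,
    VectorMeasure.integral_finsetSum_vectorMeasure fun _ _ => hint _]
  simp only [VectorMeasure.integral_smul_vectorMeasure, signedIntegral_dirac hf,
    integral_trapezoidError hf, smul_eq_mul, dotProduct]

theorem integral_interpolate_vertexWeightMeasure (h : V → ℝ) :
    ∫ᵛ z, Γ.interpolate h z ∂<•(Γ.vertexWeightMeasure b) = b ⬝ᵥ h := by
  simp [integral_vertexWeightMeasure b (continuous_interpolate h), integral_onEdge_interpolate,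
    startPoint, endPoint]

theorem vertexWeightMeasure_univ : Γ.vertexWeightMeasure b univ = b ⬝ᵥ 1 := by
  have hone : Γ.interpolate 1 = fun _ => 1 := funext (interpolate_const 1)
  rw [← integral_interpolate_vertexWeightMeasure (Γ := Γ), hone, signedIntegral_const, mul_one]

theorem integral_edgeGreen_vertexWeightMeasure (x : Γ.Point) :
    ∫ᵛ z, edgeGreen x z ∂<•(Γ.vertexWeightMeasure b) = Γ.edgeParabola x / 2 := by
  rw [integral_vertexWeightMeasure b (continuous_edgeGreen x)]
  simp only [startPoint, endPoint, edgeGreen_vertex_right, add_zero, mul_zero, zero_div, sub_zero,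
    dotProduct, Finset.sum_const_zero, zero_add]
  induction x using point_cases with
  | vertex v => simp [edgeParabola_vertex, onEdge]
  | edge e s =>
    rw [Finset.sum_eq_single e
      (fun e' _ h => by rw [integral_onEdge_edgeGreen_of_ne h.symm, mul_zero]) (by simp),
      integral_onEdge_edgeGreen_self, edgeParabola_edgePoint]
    ring

theorem voltageMeasure_vertexWeightMeasure (x : Γ.Point) :
    voltageMeasure (Γ.vertexWeightMeasure b) x x =
      Γ.interpolate (fun v => ∑ u, b u * resistance (Γ.vertex u) (Γ.vertex v)) x +
        (b ⬝ᵥ 1 - 1) * Γ.edgeParabola x +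
        ∫ᵛ z, Γ.edgeParabola z ∂<•(Γ.vertexWeightMeasure b) := by
  have hexchange : b ⬝ᵥ (fun u => Γ.interpolate (fun v => resistance (Γ.vertex u) (Γ.vertex v)) x) =
      Γ.interpolate (fun v => ∑ u, b u * resistance (Γ.vertex u) (Γ.vertex v)) x := by
    have hsum : (fun v => ∑ u, b u * resistance (Γ.vertex u) (Γ.vertex v)) =
        ∑ u, b u • fun v => resistance (Γ.vertex u) (Γ.vertex v) := by ext; simp
    simp [hsum, dotProduct]
  have hint {f : Γ.Point → ℝ} (hf : Continuous f) :=
    integrable_of_continuous (Γ.vertexWeightMeasure b) hf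
  have hI := hint <| continuous_interpolate fun u =>
    Γ.interpolate (fun v => resistance (Γ.vertex u) (Γ.vertex v)) x
  have hc := hint (continuous_const (y := Γ.edgeParabola x))
  have hP := hint (continuous_edgeParabola (Γ := Γ))
  have hg := hint ((continuous_edgeGreen x).const_mul 2)
  change ∫ᵛ z, resistance x z ∂<•(Γ.vertexWeightMeasure b) = _
  simp only [resistance_eq_interpolate x]
  rw [VectorMeasure.integral_fun_sub ((hI.fun_add hc).fun_add hP) hg,
    VectorMeasure.integral_fun_add (hI.fun_add hc) hP, VectorMeasure.integral_fun_add hI hc,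
    integral_interpolate_vertexWeightMeasure, hexchange, signedIntegral_const,
    vertexWeightMeasure_univ, signedIntegral_const_mul, integral_edgeGreen_vertexWeightMeasure]
  ring

end VertexWeightMeasure

theorem exists_equilibrium_weights [Fintype V] [Fintype E] :
    ∃ b : V → ℝ, b ⬝ᵥ 1 = 1 ∧
      ∃ c, ∀ v, ∑ u, b u * resistance (Γ.vertex u) (Γ.vertex v) = c := by
  classical
  obtain ⟨o⟩ := Γ.nonempty
  obtain ⟨G, hG⟩ := exists_isGroundedGreen Γ o
  let d : V → ℝ := fun v => G v v
  let b : V → ℝ := (1 / 2 : ℝ) • Γ.vertexLaplacian d + Pi.single o 1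
  have hmass : b ⬝ᵥ 1 = 1 := by
    simp [b, dotProduct_comm _ (1 : V → ℝ), one_dotProduct_vertexLaplacian]
  have hpotential (v : V) : b ⬝ᵥ G v = d v / 2 := by
    have hΔ : Γ.vertexLaplacian d ⬝ᵥ G v = d v := by
      rw [dotProduct_comm, dotProduct_vertexLaplacian_comm, hG.vertexLaplacian_eq]
      simp [dotProduct_sub, d, hG.map_ground]
    simp only [b, add_dotProduct, smul_dotProduct, hΔ, single_one_dotProduct, hG.map_ground,
      smul_eq_mul]
    ring
  refine ⟨b, hmass, b ⬝ᵥ d, fun v => ?_⟩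
  have hr : (fun u => resistance (Γ.vertex u) (Γ.vertex v)) =
      d + d v • (1 : V → ℝ) - (2 : ℝ) • G v :=
    funext fun u => by simp [hG.resistance_vertex, hG.symm u v, d]
  calc ∑ u, b u * resistance (Γ.vertex u) (Γ.vertex v)
    _ = b ⬝ᵥ (d + d v • (1 : V → ℝ) - (2 : ℝ) • G v) := by rw [← hr]; rfl
    _ = b ⬝ᵥ d := by
      simp only [dotProduct_sub, dotProduct_add, dotProduct_smul, hmass, hpotential, smul_eq_mul]
      ring

variable (Γ) in
theorem exists_isCanonicalMeasure [Fintype E] :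
    ∃ μ : SignedMeasure Γ.Point, IsCanonicalMeasure μ := by
  have := Γ.finite_vertices
  have := Fintype.ofFinite V
  obtain ⟨b, hb, c, hc⟩ := exists_equilibrium_weights (Γ := Γ)
  refine ⟨Γ.vertexWeightMeasure b, (vertexWeightMeasure_univ b).trans hb,
    c + ∫ᵛ z, Γ.edgeParabola z ∂<•(Γ.vertexWeightMeasure b), fun x => ?_⟩
  simp [voltageMeasure_vertexWeightMeasure, hb, hc, interpolate_const]

variable (Γ) in
theorem isCanonicalMeasure_canonicalMeasure [Fintype E] : IsCanonicalMeasure Γ.canonicalMeasure :=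
  Classical.epsilon_spec (exists_isCanonicalMeasure Γ)

/-! ### The Arakelov-Green function of the canonical measure -/

section ArakelovGreen

variable [Fintype E]

theorem voltageMeasure_eq_resistance {μ : SignedMeasure Γ.Point} (hμ : μ univ = 1)
    (x y : Γ.Point) :
    voltageMeasure μ x y =
      (voltageMeasure μ x x + voltageMeasure μ y y - resistance x y) / 2 := by
  have hr (w : Γ.Point) := (integrable_of_continuous μ (continuous_resistance w)).const_mul (1 / 2)
  have hc := integrable_of_continuous μ (continuous_const (y := resistance x y / 2))
  have hvoltage (z : Γ.Point) : voltage z x y =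
      1 / 2 * resistance x z + 1 / 2 * resistance y z - resistance x y / 2 := by
    rw [voltage_eq_resistance]
    ring
  change ∫ᵛ z, voltage z x y ∂<•μ =
    (∫ᵛ z, resistance x z ∂<•μ + ∫ᵛ z, resistance y z ∂<•μ - resistance x y) / 2
  simp only [hvoltage]
  rw [VectorMeasure.integral_fun_sub ((hr x).fun_add (hr y)) hc,
    VectorMeasure.integral_fun_add (hr x) (hr y), signedIntegral_const_mul,
    signedIntegral_const_mul, signedIntegral_const, hμ]
  ring

theorem IsCanonicalMeasure.arakelovGreen_eq {μ : SignedMeasure Γ.Point}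
    (hμ : IsCanonicalMeasure μ) (p x y : Γ.Point) :
    arakelovGreen μ x y = voltageMeasure μ p p / 2 - resistance x y / 2 := by
  obtain ⟨hmass, c, hc⟩ := hμ
  have hvoltage (x y : Γ.Point) : ∫ᵛ z, voltage z x y ∂<•μ = c - 1 / 2 * resistance x y := by
    change voltageMeasure μ x y = _
    rw [voltageMeasure_eq_resistance hmass, hc, hc]
    ring
  have hinner (y' : Γ.Point) : ∫ᵛ x', (c - 1 / 2 * resistance x' y') ∂<•μ = c / 2 := by
    simp only [resistance_comm _ y']
    rw [VectorMeasure.integral_fun_sub (integrable_of_continuous μ continuous_const)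
      ((integrable_of_continuous μ (continuous_resistance y')).const_mul _), signedIntegral_const,
      signedIntegral_const_mul, hmass]
    change 1 * c - 1 / 2 * voltageMeasure μ y' y' = c / 2
    rw [hc]
    ring
  simp only [arakelovGreen, hvoltage, hinner, signedIntegral_const, hmass, hc]
  ring

theorem tau_eq (x : Γ.Point) : Γ.tau = voltageMeasure Γ.canonicalMeasure x x / 2 :=
  let ⟨_, c, hc⟩ := isCanonicalMeasure_canonicalMeasure Γ
  Classical.epsilon_spec (p := fun t : ℝ => ∀ x, t = voltageMeasure Γ.canonicalMeasure x x / 2)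
    ⟨c / 2, fun x => by rw [hc]⟩ x

theorem arakelovGreen_canonicalMeasure (x y : Γ.Point) :
    arakelovGreen Γ.canonicalMeasure x y = Γ.tau - resistance x y / 2 := by
  rw [(isCanonicalMeasure_canonicalMeasure Γ).arakelovGreen_eq x, ← tau_eq]

end ArakelovGreen

end MetrizedGraph

end

open MetrizedGraph in
theorem theorem4p3_general {V E : Type*} [Fintype E] (Γ : MetrizedGraph V E) :
    (∀ i j : E, i ≠ j →
      ∀ (x : Set.Icc (0 : ℝ) (Γ.length i)) (y : Set.Icc (0 : ℝ) (Γ.length j)),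
        arakelovGreen Γ.canonicalMeasure (Γ.edgePoint i x) (Γ.edgePoint j y) =
          Γ.tau
            + (x : ℝ) ^ 2 *
              ((Γ.length i - resistance (Γ.startPoint i) (Γ.endPoint i)) / (2 * Γ.length i ^ 2))
            + (y : ℝ) ^ 2 *
              ((Γ.length j - resistance (Γ.startPoint j) (Γ.endPoint j)) / (2 * Γ.length j ^ 2))
            - (x : ℝ) * (y : ℝ) / (Γ.length i * Γ.length j) *
              (voltage (Γ.startPoint j) (Γ.startPoint i) (Γ.endPoint j)
                - voltage (Γ.startPoint j) (Γ.endPoint i) (Γ.endPoint j))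
            - (x : ℝ) / (2 * Γ.length i) *
              (Γ.length i - 2 * voltage (Γ.startPoint i) (Γ.endPoint i) (Γ.startPoint j))
            - (y : ℝ) / (2 * Γ.length j) *
              (Γ.length j - 2 * voltage (Γ.startPoint j) (Γ.startPoint i) (Γ.endPoint j))
            - 1 / 2 * resistance (Γ.startPoint i) (Γ.startPoint j)) ∧
    (∀ (i : E) (x y : Set.Icc (0 : ℝ) (Γ.length i)),
        arakelovGreen Γ.canonicalMeasure (Γ.edgePoint i x) (Γ.edgePoint i y) =
          Γ.tau - 1 / 2 * |(x : ℝ) - (y : ℝ)|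
            + ((x : ℝ) - (y : ℝ)) ^ 2 *
              ((Γ.length i - resistance (Γ.startPoint i) (Γ.endPoint i)) /
                (2 * Γ.length i ^ 2))) := by
  refine ⟨fun i j hij x y => ?_, fun e x y => ?_⟩
  · have hLi := (Γ.length_pos i).ne'
    have hLj := (Γ.length_pos j).ne'
    rw [arakelovGreen_canonicalMeasure, resistance_edgePoint_of_ne hij]
    simp only [voltage_eq_resistance, edgeDensity, resistance_comm (Γ.endPoint i) (Γ.startPoint i),
      resistance_comm (Γ.startPoint j)]
    field_simp
    ring
  · rw [arakelovGreen_canonicalMeasure, resistance_edgePoint_self, edgeDensity]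
    field_simp
    ring

open MetrizedGraph in
theorem theorem4p3 {V E : Type*} [Fintype V] [Fintype E] (Γ : MetrizedGraph V E) :
    (∀ i j : E, i ≠ j → ¬ Γ.IsBridge i → ¬ Γ.IsBridge j →
      ∀ (x : Set.Icc (0 : ℝ) (Γ.length i)) (y : Set.Icc (0 : ℝ) (Γ.length j)),
        arakelovGreen Γ.canonicalMeasure (Γ.edgePoint i x) (Γ.edgePoint j y) =
          Γ.tau
            + (x : ℝ) ^ 2 *
              ((Γ.length i - resistance (Γ.startPoint i) (Γ.endPoint i)) / (2 * Γ.length i ^ 2))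
            + (y : ℝ) ^ 2 *
              ((Γ.length j - resistance (Γ.startPoint j) (Γ.endPoint j)) / (2 * Γ.length j ^ 2))
            - (x : ℝ) * (y : ℝ) / (Γ.length i * Γ.length j) *
              (voltage (Γ.startPoint j) (Γ.startPoint i) (Γ.endPoint j)
                - voltage (Γ.startPoint j) (Γ.endPoint i) (Γ.endPoint j))
            - (x : ℝ) / (2 * Γ.length i) *
              (Γ.length i - 2 * voltage (Γ.startPoint i) (Γ.endPoint i) (Γ.startPoint j))
            - (y : ℝ) / (2 * Γ.length j) *
              (Γ.length j - 2 * voltage (Γ.startPoint j) (Γ.startPoint i) (Γ.endPoint j))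
            - 1 / 2 * resistance (Γ.startPoint i) (Γ.startPoint j)) ∧
    (∀ (i : E) (x y : Set.Icc (0 : ℝ) (Γ.length i)),
        arakelovGreen Γ.canonicalMeasure (Γ.edgePoint i x) (Γ.edgePoint i y) =
          Γ.tau - 1 / 2 * |(x : ℝ) - (y : ℝ)|
            + ((x : ℝ) - (y : ℝ)) ^ 2 *
              ((Γ.length i - resistance (Γ.startPoint i) (Γ.endPoint i)) /
                (2 * Γ.length i ^ 2))) :=
  ⟨fun i j hij _ _ => (theorem4p3_general Γ).1 i j hij, (theorem4p3_general Γ).2⟩
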